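/- Let $F$ be a field of characteristic $0$, let $M_2(F)$ be the algebra of $2\times 2$ matrices over $F$ with matrix units $e_{ij}$, and let $I=\langle e_{12},e_{22}\rangle_F\subset M_2(F)$ be the minimal left ideal of matrices whose first column is zero, with inclusion $\varphi\colon I\hookrightarrow M_2(F)$. Let $A=M_2(F)\oplus I$ be the associative non-unital algebra with multiplication $(a,u)(b,v)=(ab,\,av)$; thus $M_2(F)$ acts on $I$ by left multiplication, $I\,M_2(F)=0$ and $I^2=0$. Let $T_3=\{e_1,e_2\}$ be the right zero band of two elements, i.e. the semigroup with $st=t$ for all $s,t\in T_3$. Endow $A$ with the $T_3$-grading $$A^{(e_1)}=\{(a,0)\mid a\in M_2(F)\},\qquad A^{(e_2)}=\{(\varphi(u),u)\mid u\in I\}.$$ Let $F\langle X^{T_3\text{-}\mathrm{gr}}\rangle$ be the free associative algebra without unity over $F$ on the variables $x_i^{(t)}$, where $t\in T_3$ and $i=1,2,\dots$. Let $\mathrm{Id}^{T_3\text{-}\mathrm{gr}}(A)$ be the set of its elements that vanish whenever every variable $x_i^{(t)}$ is replaced by an element of $A^{(t)}$. Let $P_n^{T_3\text{-}\mathrm{gr}}$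 be the linear span of the monomials $x^{(t_1)}_{\sigma(1)}x^{(t_2)}_{\sigma(2)}\cdots x^{(t_n)}_{\sigma(n)}$ with $\sigma\in S_n$ and $t_1,\dots,t_n\in T_3$. Put $$c_n^{T_3\text{-}\mathrm{gr}}(A)=\dim_F\frac{P_n^{T_3\text{-}\mathrm{gr}}}{P_n^{T_3\text{-}\mathrm{gr}}\cap \mathrm{Id}^{T_3\text{-}\mathrm{gr}}(A)}.$$ Then the limit $\lim_{n\to\infty}\sqrt[n]{c_n^{T_3\text{-}\mathrm{gr}}(A)}$ exists and equals $3+2\sqrt2$. This number is not an integer, and $3+2\sqrt 2<\dim_F A=6$. -/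

import Mathlib

open scoped Topology

/-! Semigroup gradings and graded codimensions -/

/-- A `T`-grading on a (not necessarily unital) associative `F`-algebra `A`, for a semigroup `T`:
`A = ⨁ₜ A⁽ᵗ⁾` as a direct sum of subspaces, with `A⁽ʰ⁾ A⁽ᵗ⁾ ⊆ A⁽ʰᵗ⁾`. -/
structure SemigroupGrading (F T A : Type*) [Field F] [Semigroup T] [DecidableEq T]
    [NonUnitalRing A] [Module F A] where
  component : T → Submodule F A
  isInternal : DirectSum.IsInternal component
  mul_mem : ∀ (h t : T) (a b : A), a ∈ component h → b ∈ component t → a * b ∈ component (h * t)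

/-- The free `T`-graded associative algebra (without unity) over `F` on the variables `x⁽ᵗ⁾ᵢ`
(`t ∈ T`, `i ∈ ℕ`): the semigroup algebra of the free semigroup on the set of variables.
The variable `x⁽ᵗ⁾ᵢ` is the pair `(t, i)`. -/
abbrev FreeGradedAlgebra (F T : Type*) [Field F] : Type _ :=
  MonoidAlgebra F (FreeSemigroup (T × ℕ))

section Codimension

variable {F T A : Type*} [Field F] [Semigroup T] [DecidableEq T]
  [NonUnitalRing A] [Module F A] [IsScalarTower F A A] [SMulCommClass F A A]

/-- The value of a polynomial when the element `a (t, i)` is substituted for `x⁽ᵗ⁾ᵢ`. -/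
noncomputable def gradedEval (a : T × ℕ → A) : FreeGradedAlgebra F T →ₙₐ[F] A :=
  MonoidAlgebra.liftMagma F (FreeSemigroup.lift a)

/-- The space `Id` of graded polynomial identities: the polynomials that vanish under every
substitution of elements of `A⁽ᵗ⁾` for the variables `x⁽ᵗ⁾ᵢ`. -/
noncomputable def gradedIdentities (Γ : SemigroupGrading F T A) :
    Submodule F (FreeGradedAlgebra F T) where
  carrier := {f | ∀ a : T × ℕ → A, (∀ t i, a (t, i) ∈ Γ.component t) → gradedEval a f = 0}
  add_mem' := by
    intro f g hf hg a ha
    rw [map_add, hf a ha, hg a ha, add_zero]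
  zero_mem' := by
    intro a _
    exact map_zero _
  smul_mem' := by
    intro c f hf a ha
    rw [map_smul, hf a ha, smul_zero]

variable (F T) in
/-- The space `Pₙ` spanned by the multilinear monomials
`x⁽ᵗ¹⁾_{σ(1)} x⁽ᵗ²⁾_{σ(2)} ⋯ x⁽ᵗⁿ⁾_{σ(n)}` with `σ ∈ Sₙ`, `t₁, …, tₙ ∈ T`
(the indices of the variables run over `0, …, n - 1`). -/
noncomputable def multilinearPart (n : ℕ) : Submodule F (FreeGradedAlgebra F T) :=
  Submodule.span F {f | ∃ (w : FreeSemigroup (T × ℕ)) (σ : Equiv.Perm (Fin n)) (t : Fin n → T),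
    w.head :: w.tail = List.ofFn (fun i => (t i, (σ i : ℕ))) ∧ f = MonoidAlgebra.single w 1}

/-- The `n`th graded codimension `cₙ(A) = dim (Pₙ / (Pₙ ∩ Id))`. -/
noncomputable def gradedCodim (Γ : SemigroupGrading F T A) (n : ℕ) : ℕ :=
  Module.finrank F
    (multilinearPart F T n ⧸ (gradedIdentities Γ).submoduleOf (multilinearPart F T n))

end Codimension

/-! The right zero band of two elements -/

/-- The two-element semigroup `T₃ = {e₁, e₂}`. -/
inductive T3 : Type
  | e1 : T3
  | e2 : T3
  deriving DecidableEq

/-- `T₃` is a right zero band: `s t = t`. -/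
instance : Semigroup T3 where
  mul _ t := t
  mul_assoc _ _ _ := rfl

/-! The algebra `A = M₂(F) ⊕ I` -/

section Algebra

variable (F : Type*) [Field F]

/-- The minimal left ideal `I = ⟨e₁₂, e₂₂⟩` of `M₂(F)`: the matrices with zero first column. -/
def minimalLeftIdeal : Ideal (Matrix (Fin 2) (Fin 2) F) where
  carrier := {a | ∀ i, a i 0 = 0}
  add_mem' := by
    intro a b ha hb i
    simp [ha i, hb i]
  zero_mem' := by
    intro i
    rfl
  smul_mem' := by
    intro c a ha i
    have ha' : ∀ j, a j 0 = 0 := ha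
    simp [Matrix.mul_apply, ha']

theorem minimalLeftIdeal_eq_span :
    (minimalLeftIdeal F).restrictScalars F =
      Submodule.span F {Matrix.single 0 1 (1 : F), Matrix.single 1 1 (1 : F)} := by
  ext a
  rw [Submodule.mem_span_pair]
  constructor
  · intro ha
    have ha' : ∀ i, a i 0 = 0 := ha
    refine ⟨a 0 1, a 1 1, ?_⟩
    ext i j
    fin_cases i <;> fin_cases j <;> simp [Matrix.single, ha']
  · rintro ⟨x, y, rfl⟩ i
    fin_cases i <;> simp [Matrix.single]

/-- The vector space `A = M₂(F) ⊕ I`. -/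
def MatrixPlusIdeal : Type _ := Matrix (Fin 2) (Fin 2) F × minimalLeftIdeal F

instance : AddCommGroup (MatrixPlusIdeal F) :=
  inferInstanceAs (AddCommGroup (Matrix (Fin 2) (Fin 2) F × minimalLeftIdeal F))

instance : Module F (MatrixPlusIdeal F) :=
  inferInstanceAs (Module F (Matrix (Fin 2) (Fin 2) F × minimalLeftIdeal F))

/-- The product of `A`: `(a, u) (b, v) = (a b, a v)`, that is, `M₂(F)` acts on `I` by left
multiplication, `I M₂(F) = 0` and `I² = 0`. -/
instance : NonUnitalRing (MatrixPlusIdeal F) where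
  mul x y := (x.1 * y.1, x.1 • y.2)
  left_distrib x y z := Prod.ext (mul_add x.1 y.1 z.1) (smul_add x.1 y.2 z.2)
  right_distrib x y z := Prod.ext (add_mul x.1 y.1 z.1) (add_smul x.1 y.1 z.2)
  zero_mul x := Prod.ext (zero_mul x.1) (zero_smul _ x.2)
  mul_zero x := Prod.ext (mul_zero x.1) (smul_zero x.1)
  mul_assoc x y z := Prod.ext (mul_assoc x.1 y.1 z.1) (mul_smul x.1 y.1 z.2)

instance : IsScalarTower F (MatrixPlusIdeal F) (MatrixPlusIdeal F) where
  smul_assoc c x y := Prod.ext (smul_mul_assoc c x.1 y.1) (smul_assoc c x.1 y.2)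

instance : SMulCommClass F (MatrixPlusIdeal F) (MatrixPlusIdeal F) where
  smul_comm c x y := Prod.ext (mul_smul_comm c x.1 y.1).symm (smul_comm c x.1 y.2)

/-- The subspaces `A⁽ᵉ¹⁾ = (M₂(F), 0)` and `A⁽ᵉ²⁾ = {(φ(a), a) | a ∈ I}`, where `φ` is the
inclusion of `I` into `M₂(F)`. -/
def T3.component : T3 → Submodule F (MatrixPlusIdeal F)
  | T3.e1 =>
    { carrier := {x | x.2 = 0}
      add_mem' := fun {x y} (hx : x.2 = 0) (hy : y.2 = 0) =>
        show x.2 + y.2 = 0 by rw [hx, hy, add_zero]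
      zero_mem' := rfl
      smul_mem' := fun c x (hx : x.2 = 0) => (congrArg (c • ·) hx).trans (smul_zero (A := minimalLeftIdeal F) c) }
  | T3.e2 =>
    { carrier := {x | x.1 = (x.2 : Matrix (Fin 2) (Fin 2) F)}
      add_mem' := fun {x y} hx hy => congrArg₂ (· + ·) hx hy
      zero_mem' := rfl
      smul_mem' := fun c _ hx => congrArg (c • ·) hx }

/-- The `T₃`-grading on `A`. -/
def T3.grading : SemigroupGrading F T3 (MatrixPlusIdeal F) where
  component := T3.component F
  isInternal := by
    have huniv : (Set.univ : Set T3) = {T3.e1, T3.e2} := by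
      ext t
      cases t <;> simp
    refine (DirectSum.isInternal_submodule_iff_isCompl (T3.component F)
      (i := T3.e1) (j := T3.e2) (by decide) huniv).2 ⟨?_, ?_⟩
    · rw [Submodule.disjoint_def]
      intro x (h1 : x.2 = 0) (h2 : x.1 = (x.2 : Matrix (Fin 2) (Fin 2) F))
      refine Prod.ext ?_ h1
      rw [h2, h1]
      rfl
    · rw [codisjoint_iff, eq_top_iff]
      intro x _
      refine Submodule.mem_sup.2 ⟨((x.1 - (x.2 : Matrix (Fin 2) (Fin 2) F), 0) :
        Matrix (Fin 2) (Fin 2) F × minimalLeftIdeal F), rfl,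
        (((x.2 : Matrix (Fin 2) (Fin 2) F), x.2) :
        Matrix (Fin 2) (Fin 2) F × minimalLeftIdeal F), rfl, ?_⟩
      exact Prod.ext (sub_add_cancel _ _) (zero_add _)
  mul_mem := by
    rintro h (_ | _) a b - hb
    · change a.1 • b.2 = 0
      rw [show b.2 = 0 from hb, smul_zero]
    · exact congrArg (a.1 * ·) hb

end Algebra

/-! Upper bound. By multilinearity a polynomial in `multilinearPart` is an identity iff it vanishes
at all tuples of homogeneous matrix units, four of type `e1` and two of type `e2`. A monomial is
nonzero at such a tuple only if the units form a path, so their weights (column minus row) telescope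
to a sum in {-1, 0, 1}. The generating function of the weights is 3 + x + 2/x up to inverting the
variable, with minimum 3 + 2√2 at x = √2. This bounds the number of such tuples
(`card_balancedLabels_le`), hence the codimension.

Lower bound. Encode a tuple as (K, A, B): the variables of type `e1`, with left column, with upper
row; thus A ⊆ K. By Cauchy–Schwarz there are at least (3 + 2√2)^n / (n + 1) triples with |A| = |B|.
Order the variables along a cyclic permutation σ. With matching types, the monomial has lower right
entry nonzero at a triple exactly when σ carries A onto B. If A dominates B with respect to a
height, some cyclic σ moves A weakly up and K \ A strictly down
(`IsDominating.exists_isCompatible_sameCycle`). Then (A, B) has the largest `heightWeight` among the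
triples where its monomial survives, so the matrix of values is triangular and the monomials are
independent modulo the identities (`card_le_gradedCodim`). A cycle-lemma argument gives one rotated
height for which at least a 1/(n + 1) share of the triples is dominating. Two extra variables make
dominance strict; polynomial factors disappear in the nth root. -/

/-! Compatible permutations -/

section Combinatorics

open Finset Equiv

variable {V : Type*} [DecidableEq V]

/-- The admissible targets of a point are nested by height, so Hall's condition for a set follows
from that for the superlevel set of its lowest point. -/
theorem exists_injOn_le_of_card_filter_le {S T : Finset V} {p q : V → ℤ}
    (h : ∀ x ∈ S, #{s ∈ S | p x ≤ p s} ≤ #{t ∈ T | p x ≤ q t}) :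
    ∃ f : V → V, Set.InjOn f S ∧ ∀ s ∈ S, f s ∈ T ∧ p s ≤ q (f s) := by
  obtain ⟨f, hf, hfT⟩ := (all_card_le_biUnion_card_iff_exists_injective
    (fun x : S => {t ∈ T | p x ≤ q t})).1 (by
      intro s
      rcases s.eq_empty_or_nonempty with rfl | hs
      · simp
      obtain ⟨x, hx, hmin⟩ := s.exists_min_image (fun x => p x) hs
      calc #s = #(s.map (Function.Embedding.subtype _)) := (card_map _).symm
        _ ≤ #{s ∈ S | p x ≤ p s} := by
          refine card_le_card fun y hy => ?_
          obtain ⟨y', hy', rfl⟩ := mem_map.1 hy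
          exact mem_filter.2 ⟨y'.2, hmin y' hy'⟩
        _ ≤ #{t ∈ T | p x ≤ q t} := h x x.2
        _ ≤ _ := card_le_card (subset_biUnion_of_mem (fun x : S => {t ∈ T | p x ≤ q t}) hx))
  refine ⟨fun v => if hv : v ∈ S then f ⟨v, hv⟩ else v, ?_, ?_⟩
  · intro a ha b hb hab
    have ha' : a ∈ S := ha
    have hb' : b ∈ S := hb
    simp only [ha', hb', dif_pos] at hab
    simpa using hf hab
  · intro s hs
    simpa [hs] using hfT ⟨s, hs⟩

/-- `σ` maps `A` into `B` weakly upwards, `K \ A` into the complement of `B` strictly downwards,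
and the complement of `K` into the complement of `B`; here `pos` is the height. -/
structure IsCompatible (pos : V → ℤ) (K A B : Finset V) (σ : Perm V) : Prop where
  up : ∀ j ∈ A, σ j ∈ B ∧ pos j ≤ pos (σ j)
  down : ∀ j ∈ K, j ∉ A → σ j ∉ B ∧ pos (σ j) < pos j
  off : ∀ j ∉ K, σ j ∉ B

/-- `A` dominates `B` below every level between those of `z` and `w`. -/
structure IsDominating (pos : V → ℤ) (K A B : Finset V) (z w : V) : Prop where
  injective : Function.Injective pos
  subset : A ⊆ K
  z_mem : z ∈ A
  z_notMem : z ∉ B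
  w_notMem : w ∉ K
  w_mem : w ∈ B
  card_eq : #A = #B
  z_le : ∀ v, pos z ≤ pos v
  le_w : ∀ v, pos v ≤ pos w
  lt : ∀ p, pos z < p → p ≤ pos w → #{b ∈ B | pos b < p} < #{a ∈ A | pos a < p}

variable {pos : V → ℤ} {K A B : Finset V} {z w : V}

/-- Two matchings: A into B upwards, and K \ A into the complement of B strictly downwards. Since
|A| = |B|, the first is onto B, so any extension to a permutation sends the complement of K outside
B. -/
theorem IsDominating.exists_isCompatible [Fintype V] (h : IsDominating pos K A B z w) :
    ∃ σ : Perm V, IsCompatible pos K A B σ := by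
  have split : ∀ (S : Finset V) (p : ℤ), #{s ∈ S | pos s < p} + #{s ∈ S | p ≤ pos s} = #S := by
    intro S p
    rw [← card_filter_add_card_filter_not (s := S) (fun s => pos s < p)]
    simp only [not_lt]
  obtain ⟨f, hf, hfB⟩ := exists_injOn_le_of_card_filter_le (S := A) (T := B) (p := pos) (q := pos)
    (by
      intro x hx
      have h1 := split A (pos x)
      have h2 := split B (pos x)
      have h3 := h.card_eq
      have h4 : #{b ∈ B | pos b < pos x} ≤ #{a ∈ A | pos a < pos x} := by
        rcases (h.z_le x).eq_or_lt with hz | hz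
        · rw [filter_false_of_mem (fun b _ => by have := h.z_le b; omega)]
          simp
        · exact (h.lt _ hz (h.le_w x)).le
      omega)
  obtain ⟨g, hg, hgB⟩ := exists_injOn_le_of_card_filter_le (S := K \ A) (T := univ \ B)
    (p := fun v => -pos v) (q := fun v => -pos v - 1)
    (by
      intro x hx
      rw [mem_sdiff] at hx
      have hxz : pos z < pos x := lt_of_le_of_ne (h.z_le x) fun e =>
        hx.2 (h.injective e ▸ h.z_mem)
      have hxw : pos x < pos w := lt_of_le_of_ne (h.le_w x) fun e =>
        h.w_notMem (h.injective e ▸ hx.1)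
      -- Strict dominance gains one place, which pays for the exclusion of `x` itself as a target.
      have h1 := h.lt (pos x + 1) (by omega) (by omega)
      have e1 : #{s ∈ K \ A | -pos x ≤ -pos s} + #{a ∈ A | pos a < pos x + 1}
          = #{k ∈ K | pos k < pos x + 1} := by
        rw [← card_union_of_disjoint]
        · congr 1
          ext v
          have := @h.subset v
          simp only [mem_union, mem_filter, mem_sdiff]
          constructor
          · rintro (⟨hv, hp⟩ | ⟨hv, hp⟩)
            · exact ⟨hv.1, by omega⟩
            · exact ⟨this hv, hp⟩
          · rintro ⟨hv, hp⟩
            by_cases hA : v ∈ A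
            · exact .inr ⟨hA, hp⟩
            · exact .inl ⟨⟨hv, hA⟩, by omega⟩
        · refine disjoint_left.2 fun v hv hv' => ?_
          exact (mem_sdiff.1 (mem_filter.1 hv).1).2 (mem_filter.1 hv').1
      have e2 : #{k ∈ K | pos k < pos x + 1} ≤
          #({t ∈ univ \ B | -pos x ≤ -pos t - 1} ∪ {b ∈ B | pos b < pos x + 1} ∪ {x}) := by
        refine card_le_card fun v hv => ?_
        have hp := (mem_filter.1 hv).2
        by_cases hvB : v ∈ B
        · have : pos v ≤ pos x := by omega
          simp [hvB, this]
        · by_cases hvx : v = x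
          · simp [hvx]
          · have : pos v ≠ pos x := fun e => hvx (h.injective e)
            simp only [mem_union, mem_filter, mem_sdiff, mem_univ, true_and]
            exact .inl (.inl ⟨hvB, by omega⟩)
      have e3 := card_union_le ({t ∈ univ \ B | -pos x ≤ -pos t - 1} ∪
        {b ∈ B | pos b < pos x + 1}) {x}
      have e4 := card_union_le {t ∈ univ \ B | -pos x ≤ -pos t - 1} {b ∈ B | pos b < pos x + 1}
      rw [card_singleton] at e3
      omega)
  have hinj : Set.InjOn (fun v => if v ∈ A then f v else g v) K := by
    intro a ha b hb hab
    by_cases hA : a ∈ A <;> by_cases hB : b ∈ A <;> simp only [hA, hB, if_true, if_false] at hab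
    · exact hf hA hB hab
    · have := (hgB b (mem_sdiff.2 ⟨hb, hB⟩)).1
      rw [← hab, mem_sdiff] at this
      exact absurd (hfB a hA).1 this.2
    · have := (hgB a (mem_sdiff.2 ⟨ha, hA⟩)).1
      rw [hab, mem_sdiff] at this
      exact absurd (hfB b hB).1 this.2
    · exact hg (by simpa using ⟨ha, hA⟩) (by simpa using ⟨hb, hB⟩) hab
  obtain ⟨e, he⟩ := exists_equiv_extend_of_card_eq (card_univ (α := V)).symm
    (subset_univ (image (fun v => if v ∈ A then f v else g v) K)) hinj
  let σ : Perm V := e.trans (Equiv.subtypeUnivEquiv mem_univ)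
  have hσ : ∀ v ∈ K, σ v = if v ∈ A then f v else g v := fun v hv => he v hv
  have hup : ∀ j ∈ A, σ j = f j := fun j hj => by rw [hσ j (h.subset hj), if_pos hj]
  have himage : Finset.image σ A = B := by
    refine eq_of_subset_of_card_le ?_ ?_
    · intro b hb
      obtain ⟨a, ha, rfl⟩ := mem_image.1 hb
      rw [hup a ha]
      exact (hfB a ha).1
    · rw [card_image_of_injective _ σ.injective, h.card_eq]
  refine ⟨σ, ⟨fun j hj => ?_, fun j hj hjA => ?_, fun j hj hjB => ?_⟩⟩
  · rw [hup j hj]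
    exact hfB j hj
  · rw [hσ j hj, if_neg hjA]
    have := hgB j (mem_sdiff.2 ⟨hj, hjA⟩)
    exact ⟨(mem_sdiff.1 this.1).2, by omega⟩
  · rw [← himage] at hjB
    obtain ⟨a, ha, e⟩ := mem_image.1 hjB
    exact hj (σ.injective e ▸ h.subset ha)

/-! ### Merging cycles by transpositions -/

theorem sameCycle_mul_swap_pow {σ : Perm V} {i j : V} (h : ¬σ.SameCycle i j) (t : ℕ) :
    (σ * swap i j).SameCycle i ((σ ^ (t + 1)) j) := by
  have hi : (σ * swap i j).SameCycle i (σ j) := ⟨1, by simp⟩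
  induction t with
  | zero => simpa using hi
  | succ t ih =>
    rw [pow_succ', Perm.mul_apply]
    by_cases hj : (σ ^ (t + 1)) j = j
    · rwa [hj]
    · have hne : (σ ^ (t + 1)) j ≠ i := fun e =>
        h (Perm.SameCycle.symm ⟨(t + 1 : ℕ), by rw [zpow_natCast, e]⟩)
      refine ih.trans ⟨1, ?_⟩
      rw [zpow_one, Perm.mul_apply, swap_apply_of_ne_of_ne hne hj]

theorem sameCycle_mul_swap [Finite V] {σ : Perm V} {i j v : V} (h : ¬σ.SameCycle i j)
    (hv : σ.SameCycle i v ∨ σ.SameCycle j v) : (σ * swap i j).SameCycle i v := by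
  have key : ∀ {i j u : V}, ¬σ.SameCycle i j → σ.SameCycle j u →
      (σ * swap i j).SameCycle i u := by
    intro i j u hij hu
    obtain ⟨n, hn, -, rfl⟩ := hu.exists_pow_eq''
    obtain ⟨t, rfl⟩ := Nat.exists_eq_add_one.2 hn
    exact sameCycle_mul_swap_pow hij t
  rcases hv with hv | hv
  · have := key (fun e => h e.symm) hv
    rw [swap_comm] at this
    exact (key h (Perm.SameCycle.refl σ j)).trans this
  · exact key h hv

/-- Take a compatible permutation whose cycle through `z` is largest. Any transposition that
preserves compatibility and joins this cycle to another would enlarge it; such transpositions exist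
as long as a point of A or a point outside K is missing. -/
theorem IsDominating.exists_isCompatible_sameCycle [Fintype V] (h : IsDominating pos K A B z w) :
    ∃ σ : Perm V, IsCompatible pos K A B σ ∧ ∀ v, σ.SameCycle z v := by
  classical
  obtain ⟨σ₀, h₀⟩ := h.exists_isCompatible
  obtain ⟨σ, hσ, hmax⟩ := exists_max_image {σ : Perm V | IsCompatible pos K A B σ}
    (fun σ => #{v | σ.SameCycle z v}) ⟨σ₀, by simpa using h₀⟩
  replace hσ : IsCompatible pos K A B σ := by simpa using hσ
  have hswap : ∀ i j, σ.SameCycle z i → ¬σ.SameCycle z j →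
      ¬IsCompatible pos K A B (σ * swap i j) := by
    intro i j hi hj hc
    have hij : ¬σ.SameCycle i j := fun e => hj (hi.trans e)
    refine (hmax (σ * swap i j) (by simpa using hc)).not_gt (card_lt_card ?_)
    have hz : (σ * swap i j).SameCycle z i := (sameCycle_mul_swap hij (.inl hi.symm)).symm
    refine (ssubset_iff_of_subset ?_).2 ⟨j, ?_, ?_⟩
    · intro v hv
      have hv : σ.SameCycle z v := by simpa using hv
      simpa using hz.trans (sameCycle_mul_swap hij (.inl (hi.symm.trans hv)))
    · simpa using hz.trans (sameCycle_mul_swap hij (.inr (Perm.SameCycle.refl σ j)))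
    · simpa using hj
  have hA : ∀ j ∈ A, σ.SameCycle z j := by
    by_contra! hex
    obtain ⟨j, hj, hmin⟩ := exists_min_image {j ∈ A | ¬σ.SameCycle z j} pos
      (by obtain ⟨j, hj⟩ := hex; exact ⟨j, by simpa using hj⟩)
    simp only [mem_filter] at hj hmin
    have hzj : pos z < pos j := lt_of_le_of_ne (h.z_le j) fun e =>
      hj.2 (h.injective e ▸ Perm.SameCycle.refl σ z)
    -- Otherwise σ would inject the points of A below `j` into the points of B below `j`, against
    -- strict dominance. As `σ i` and `σ j` both lie at or above `j`, exchanging the images of `i`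
    -- and `j` keeps A moving upwards.
    obtain ⟨i, hi, hip, hiσ⟩ : ∃ i ∈ A, pos i < pos j ∧ pos j ≤ pos (σ i) := by
      by_contra! hno
      refine (h.lt (pos j) hzj (h.le_w j)).not_ge ?_
      rw [← card_image_of_injective {a ∈ A | pos a < pos j} σ.injective]
      refine card_le_card fun b hb => ?_
      obtain ⟨a, ha, rfl⟩ := mem_image.1 hb
      rw [mem_filter] at ha ⊢
      exact ⟨(hσ.up a ha.1).1, hno a ha.1 ha.2⟩
    have hzi : σ.SameCycle z i := by
      by_contra hzi
      exact absurd (hmin i ⟨hi, hzi⟩) (by omega)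
    have hup := hσ.up j hj.1
    have hne : i ≠ j := fun e => hj.2 (e ▸ hzi)
    refine hswap i j hzi hj.2 ⟨fun v hv => ?_, fun v hv hvA => ?_, fun v hv => ?_⟩ <;>
      rw [Perm.mul_apply]
    · by_cases hvi : v = i
      · subst hvi
        rw [swap_apply_left]
        exact ⟨hup.1, by omega⟩
      · by_cases hvj : v = j
        · subst hvj
          rw [swap_apply_right]
          exact ⟨(hσ.up i hi).1, hiσ⟩
        · rw [swap_apply_of_ne_of_ne hvi hvj]
          exact hσ.up v hv
    · rw [swap_apply_of_ne_of_ne (by rintro rfl; exact hvA hi) (by rintro rfl; exact hvA hj.1)]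
      exact hσ.down v hv hvA
    · rw [swap_apply_of_ne_of_ne (by rintro rfl; exact hv (h.subset hi))
        (by rintro rfl; exact hv (h.subset hj.1))]
      exact hσ.off v hv
  have hw : σ.SameCycle z w := by
    have himage : Finset.image σ A = B := by
      refine eq_of_subset_of_card_le ?_ ?_
      · intro b hb
        obtain ⟨a, ha, rfl⟩ := mem_image.1 hb
        exact (hσ.up a ha).1
      · rw [card_image_of_injective _ σ.injective, h.card_eq]
    have := h.w_mem
    rw [← himage] at this
    obtain ⟨a, ha, rfl⟩ := mem_image.1 this
    exact (hA a ha).trans ⟨1, by simp⟩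
  have hoff : ∀ y ∉ K, σ.SameCycle z y := by
    intro y hy
    -- Both `w` and `y` lie outside K, where the only condition is to avoid B, so their images may
    -- be exchanged freely.
    by_contra hzy
    have hmem : ∀ {v}, v ∈ K → swap w y v = v := fun {v} hv =>
      swap_apply_of_ne_of_ne (by rintro rfl; exact h.w_notMem hv) (by rintro rfl; exact hy hv)
    refine hswap w y hw hzy ⟨fun v hv => ?_, fun v hv hvA => ?_, fun v hv => ?_⟩ <;>
      rw [Perm.mul_apply]
    · rw [hmem (h.subset hv)]
      exact hσ.up v hv
    · rw [hmem hv]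
      exact hσ.down v hv hvA
    · by_cases hvw : v = w
      · rw [hvw, swap_apply_left]
        exact hσ.off y hy
      · by_cases hvy : v = y
        · rw [hvy, swap_apply_right]
          exact hσ.off w h.w_notMem
        · rw [swap_apply_of_ne_of_ne hvw hvy]
          exact hσ.off v hv
  refine ⟨σ, hσ, ?_⟩
  by_contra! hex
  obtain ⟨v, hv, hmin⟩ := exists_min_image {v | ¬σ.SameCycle z v} pos
    (by obtain ⟨v, hv⟩ := hex; exact ⟨v, by simpa using hv⟩)
  simp only [mem_filter, mem_univ, true_and] at hv hmin
  have hvK : v ∈ K := by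
    by_contra hvK
    exact hv (hoff v hvK)
  -- The lowest missing point lies in K \ A, so its image is a still lower missing point.
  have h1 := (hσ.down v hvK fun hvA => hv (hA v hvA)).2
  exact (hmin (σ v) fun e => hv (e.trans (Perm.SameCycle.symm ⟨1, by simp⟩))).not_gt h1

/-- The weight that is maximal at `(A, B)` among the pairs related by a compatible permutation. -/
def heightWeight {V : Type*} (pos : V → ℤ) (A B : Finset V) : ℤ :=
  ∑ b ∈ B, 2 * pos b - ∑ a ∈ A, (2 * pos a - 1)

theorem heightWeight_eq_sum {V : Type*} {pos : V → ℤ} {A B : Finset V} {σ : Perm V}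
    (hAB : ∀ v, v ∈ A ↔ σ v ∈ B) :
    heightWeight pos A B = ∑ a ∈ A, (2 * pos (σ a) - 2 * pos a + 1) := by
  have : B = A.map σ.toEmbedding := by
    ext b
    obtain ⟨v, rfl⟩ := σ.surjective b
    simp [hAB]
  rw [heightWeight, this, sum_map, ← sum_sub_distrib]
  refine sum_congr rfl fun a _ => ?_
  simp only [coe_toEmbedding]
  ring

theorem IsCompatible.mem_iff {σ : Perm V} (hσ : IsCompatible pos K A B σ) (v : V) :
    v ∈ A ↔ σ v ∈ B := by
  refine ⟨fun hv => (hσ.up v hv).1, fun hv => ?_⟩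
  by_contra hvA
  by_cases hvK : v ∈ K
  · exact (hσ.down v hvK hvA).1 hv
  · exact hσ.off v hvK hv

/-- The weight is a sum over A of odd terms 2(pos (σ a) - pos a) + 1. On K these are at least 1 in A
and at most -1 outside A, so A is the unique maximizer among subsets of K. -/
theorem IsCompatible.heightWeight_lt {σ : Perm V} (hσ : IsCompatible pos K A B σ)
    (hAK : A ⊆ K) {A' B' : Finset V} (hA' : A' ⊆ K) (hAB' : ∀ v, v ∈ A' ↔ σ v ∈ B')
    (hne : (A', B') ≠ (A, B)) : heightWeight pos A' B' < heightWeight pos A B := by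
  have hAA : A' ≠ A := by
    rintro rfl
    refine hne (Prod.ext rfl ?_)
    ext b
    obtain ⟨v, rfl⟩ := σ.surjective b
    rw [← hAB', hσ.mem_iff]
  rw [heightWeight_eq_sum hσ.mem_iff, heightWeight_eq_sum hAB',
    ← sum_inter_add_sum_sdiff A' A, ← sum_inter_add_sum_sdiff A A', inter_comm A A']
  have h1 : ∑ a ∈ A' \ A, (2 * pos (σ a) - 2 * pos a + 1) ≤ ∑ a ∈ A' \ A, (-1 : ℤ) := by
    refine sum_le_sum fun a ha => ?_
    rw [mem_sdiff] at ha
    have := (hσ.down a (hA' ha.1) ha.2).2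
    omega
  have h2 : ∑ a ∈ A \ A', (1 : ℤ) ≤ ∑ a ∈ A \ A', (2 * pos (σ a) - 2 * pos a + 1) := by
    refine sum_le_sum fun a ha => ?_
    rw [mem_sdiff] at ha
    have := (hσ.up a ha.1).2
    omega
  have h3 : (A' \ A).Nonempty ∨ (A \ A').Nonempty := by
    by_contra! hno
    rw [sdiff_eq_empty_iff_subset, sdiff_eq_empty_iff_subset] at hno
    exact hAA (hno.1.antisymm hno.2)
  simp only [sum_const] at h1 h2
  rw [← card_pos, ← card_pos] at h3
  simp only [nsmul_eq_mul] at h1 h2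
  omega

end Combinatorics

/-! Counting admissible triples -/

section Counting

open Finset

/-- The triples `(K, A, B)` of subsets of an `n`-element set with `A ⊆ K` and `|A| = |B|`. -/
def admissibleTriples (n : ℕ) : Finset (Finset (Fin n) × Finset (Fin n) × Finset (Fin n)) :=
  {g | g.2.1 ⊆ g.1 ∧ #g.2.1 = #g.2.2}

theorem card_admissibleTriples (n : ℕ) :
    #(admissibleTriples n) =
      ∑ A : Finset (Fin n), ∑ B : Finset (Fin n), if #A = #B then 2 ^ (n - #A) else 0 := by
  rw [admissibleTriples, card_filter, Fintype.sum_prod_type, sum_comm, Fintype.sum_prod_type]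
  refine sum_congr rfl fun A _ => sum_congr rfl fun B _ => ?_
  split_ifs with h
  · simp only [h, and_true]
    rw [← card_filter, ← h]
    have := card_Icc_finset (subset_univ A)
    rw [card_univ, Fintype.card_fin] at this
    rw [← this]
    congr 1
    ext K
    simp
  · simp [h]

/-- Cauchy–Schwarz over the n + 1 possible sizes, applied to (1 + √2)^n = ∑ C(n, a) √2^(n - a),
whose square is (3 + 2√2)^n. -/
theorem pow_le_card_admissibleTriples (n : ℕ) :
    (3 + 2 * √2) ^ n ≤ (n + 1 : ℝ) * #(admissibleTriples n) := by
  have h2 : √2 * √2 = 2 := Real.mul_self_sqrt (by norm_num)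
  let f : Finset (Fin n) → ℝ := fun A => √2 ^ (n - #A)
  have hf : ∑ A, f A = (1 + √2) ^ n := by
    have := Fintype.sum_pow_mul_eq_add_pow (Fin n) (1 : ℝ) √2
    simpa [f] using this
  have hmaps : ∀ A ∈ (univ : Finset (Finset (Fin n))), #A ∈ range (n + 1) := fun A _ =>
    mem_range_succ_iff.2 (by simpa using card_le_univ A)
  calc (3 + 2 * √2) ^ n = (∑ A, f A) ^ 2 := by
        rw [hf, ← pow_mul, mul_comm n 2, pow_mul]
        congr 1
        linear_combination -h2
    _ = (∑ a ∈ range (n + 1), ∑ A with #A = a, f A) ^ 2 := by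
        rw [sum_fiberwise_of_maps_to hmaps]
    _ ≤ #(range (n + 1)) * ∑ a ∈ range (n + 1), (∑ A with #A = a, f A) ^ 2 :=
        sq_sum_le_card_mul_sum_sq
    _ = (n + 1 : ℝ) * #(admissibleTriples n) := by
        rw [card_range, card_admissibleTriples, ← sum_fiberwise_of_maps_to hmaps]
        push_cast
        congr 1
        refine sum_congr rfl fun a _ => ?_
        rw [sq, sum_mul]
        refine sum_congr rfl fun A hA => ?_
        rw [mul_sum, sum_filter]
        have hA' : #A = a := (mem_filter.1 hA).2
        refine sum_congr rfl fun B _ => ?_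
        by_cases hB : #B = a
        · simp only [f, hA', hB, if_true]
          rw [← mul_pow, h2]
        · simp [hA', hB, Ne.symm hB]

/-- The height on an `n`-element set, cyclically rotated by `r`. -/
def rotatedHeight {n : ℕ} (r : ℕ) (i : Fin n) : ℤ :=
  if (i : ℕ) < r then i + n else i

/-- Cycle lemma: start reading where the excess of A over B among the initial points is minimal. -/
theorem exists_rotatedHeight_card_le {n : ℕ} {A B : Finset (Fin n)} (h : #A = #B) :
    ∃ r ∈ range (n + 1), ∀ p : ℤ,
      #{b ∈ B | rotatedHeight r b < p} ≤ #{a ∈ A | rotatedHeight r a < p} := by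
  let c : Finset (Fin n) → ℕ → ℕ := fun S x => #{i ∈ S | i.val < x}
  obtain ⟨r, hr, hmin⟩ := exists_min_image (range (n + 1)) (fun x => (c A x : ℤ) - c B x) ⟨0, by simp⟩
  refine ⟨r, hr, fun p => ?_⟩
  rw [mem_range] at hr
  have hn : ∀ S, c S n = #S := fun S => by
    simp only [c]
    rw [filter_true_of_mem fun i _ => i.2]
  rcases le_or_gt p r with hpr | hpr
  · rw [filter_false_of_mem]
    · simp
    · intro b _
      rw [rotatedHeight]
      split_ifs <;> omega
  rcases le_or_gt p n with hpn | hpn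
  · have key : ∀ S : Finset (Fin n), #{i ∈ S | rotatedHeight r i < p} + c S r = c S p.toNat := by
      intro S
      simp only [c, card_filter]
      rw [← sum_add_distrib]
      refine sum_congr rfl fun i _ => ?_
      rw [rotatedHeight]
      split_ifs <;> omega
    have h1 := key A
    have h2 := key B
    have h3 := hmin p.toNat (by rw [mem_range]; omega)
    omega
  -- Above level n the wrapped points i + n with i < r enter; there are none beyond r, hence the
  -- `min`.
  · have key : ∀ S : Finset (Fin n), #{i ∈ S | rotatedHeight r i < p} + c S r =
        c S n + c S (min r (p - n).toNat) := by
      intro S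
      simp only [c, card_filter]
      rw [← sum_add_distrib, ← sum_add_distrib]
      refine sum_congr rfl fun i _ => ?_
      rw [rotatedHeight]
      have := i.2
      split_ifs <;> omega
    have h1 := key A
    have h2 := key B
    have h3 := hmin (min r (p - n).toNat) (by rw [mem_range]; omega)
    rw [hn] at h1 h2
    omega

open Classical in
/-- The admissible triples in which `A` dominates `B` with respect to the rotated height. -/
noncomputable def dominatingTriples (n r : ℕ) : Finset (Finset (Fin n) × Finset (Fin n) × Finset (Fin n)) :=
  {g ∈ admissibleTriples n | ∀ p : ℤ,
    #{b ∈ g.2.2 | rotatedHeight r b < p} ≤ #{a ∈ g.2.1 | rotatedHeight r a < p}}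

/-- Pigeonhole over the rotations. A single `r` must serve all triples, because triangularity
compares weights for one common height. -/
theorem exists_pow_le_card_dominatingTriples (n : ℕ) :
    ∃ r, (3 + 2 * √2) ^ n ≤ (n + 1 : ℝ) ^ 2 * #(dominatingTriples n r) := by
  have hcover : admissibleTriples n ⊆ (range (n + 1)).biUnion (dominatingTriples n) := by
    intro g hg
    obtain ⟨r, hr, h⟩ := exists_rotatedHeight_card_le (mem_filter.1 hg).2.2
    exact mem_biUnion.2 ⟨r, hr, by simpa [dominatingTriples] using ⟨hg, h⟩⟩
  obtain ⟨r, -, hmax⟩ := exists_max_image (range (n + 1)) (fun r => #(dominatingTriples n r))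
    ⟨0, by simp⟩
  refine ⟨r, (pow_le_card_admissibleTriples n).trans ?_⟩
  have h := (card_le_card hcover).trans (card_biUnion_le_card_mul _ _ _ hmax)
  rw [card_range] at h
  rw [sq, mul_assoc]
  refine mul_le_mul_of_nonneg_left ?_ (by positivity)
  exact_mod_cast h

/-- The rotated height extended to an additional lowest and an additional highest point. -/
def extendedHeight (n r : ℕ) : Fin n ⊕ Bool → ℤ :=
  Sum.elim (rotatedHeight r) fun b => if b then 2 * n else -1

/-- The lowest point is added to A and the highest to B, so at every level in between A gains one
and B nothing: weak dominance becomes strict. -/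
theorem isDominating_of_mem_dominatingTriples {n r : ℕ}
    {g : Finset (Fin n) × Finset (Fin n) × Finset (Fin n)} (hg : g ∈ dominatingTriples n r) :
    IsDominating (extendedHeight n r) (g.1.disjSum {false}) (g.2.1.disjSum {false})
      (g.2.2.disjSum {true}) (.inr false) (.inr true) := by
  obtain ⟨K, A, B⟩ := g
  simp only [dominatingTriples, admissibleTriples, mem_filter, mem_univ,
    true_and] at hg
  obtain ⟨⟨hAK, hcard⟩, hdom⟩ := hg
  have hrot : ∀ i : Fin n, 0 ≤ rotatedHeight r i ∧ rotatedHeight r i < 2 * n := by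
    intro i
    have := i.2
    rw [rotatedHeight]
    split_ifs <;> omega
  have hcount : ∀ (S : Finset (Fin n)) (b : Bool) (p : ℤ),
      #{v ∈ S.disjSum {b} | extendedHeight n r v < p} =
        #{i ∈ S | rotatedHeight r i < p} + if (if b then 2 * n else -1 : ℤ) < p then 1 else 0 := by
    intro S b p
    rw [card_filter, card_filter, sum_disjSum, sum_singleton]
    rfl
  refine ⟨?_, ?_, by simp, by simp, by simp, by simp, by simp [hcard], ?_, ?_, ?_⟩
  · rintro (i | a) (j | b) h
    · simp only [extendedHeight, Sum.elim_inl, rotatedHeight] at h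
      refine congrArg _ (Fin.ext ?_)
      have := i.2
      have := j.2
      split_ifs at h <;> omega
    · have := hrot i
      simp only [extendedHeight, Sum.elim_inl, Sum.elim_inr] at h
      split_ifs at h <;> omega
    · have := hrot j
      simp only [extendedHeight, Sum.elim_inl, Sum.elim_inr] at h
      split_ifs at h <;> omega
    · simp only [extendedHeight, Sum.elim_inr] at h
      cases a <;> cases b <;> simp at h ⊢ <;> omega
  · exact disjSum_mono hAK subset_rfl
  · rintro (i | a)
    · have := hrot i
      simp [extendedHeight]
      omega
    · cases a <;> simp [extendedHeight]
      omega
  · rintro (i | a)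
    · have := hrot i
      simp [extendedHeight]
      omega
    · cases a <;> simp [extendedHeight]
      omega
  · intro p hp hp'
    simp only [extendedHeight, Sum.elim_inr] at hp hp'
    simp at hp hp'
    rw [hcount, hcount]
    have := hdom p
    simp
    split_ifs <;> omega

end Counting

/-! Homogeneous matrix units -/

section Algebra

open Finset

/-- The unitization makes list products and multilinear products available for the non-unital
algebra. -/
theorem FreeSemigroup.inr_lift {F A α : Type*} [Field F] [NonUnitalRing A] [Module F A]
    [IsScalarTower F A A] [SMulCommClass F A A] (a : α → A) (w : FreeSemigroup α) :
    (Unitization.inr (FreeSemigroup.lift a w) : Unitization F A) =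
      ((w.head :: w.tail).map fun v => (Unitization.inr (a v) : Unitization F A)).prod := by
  obtain ⟨x, xs⟩ := w
  rw [FreeSemigroup.lift_mk_eq_foldl, List.map_cons, List.prod_cons]
  generalize a x = y
  induction xs generalizing y with
  | nil => simp
  | cons z zs ih => rw [List.foldl_cons, ih, List.map_cons, List.prod_cons, Unitization.inr_mul,
      mul_assoc]

variable (F : Type*) [Field F]

namespace MatrixPlusIdeal

variable {F} in
theorem ext_matrix {x y : MatrixPlusIdeal F} (h1 : x.1 = y.1)
    (h2 : (x.2 : Matrix (Fin 2) (Fin 2) F) = y.2) : x = y :=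
  Prod.ext h1 (Subtype.ext h2)

/-- The projection of `A` onto `M₂(F)`. -/
def fstₗ : MatrixPlusIdeal F →ₗ[F] Matrix (Fin 2) (Fin 2) F where
  toFun x := x.1
  map_add' _ _ := rfl
  map_smul' _ _ := rfl

/-- The coordinates of the elements of the minimal left ideal. -/
def idealEquiv : minimalLeftIdeal F ≃ₗ[F] (Fin 2 → F) where
  toFun u i := (u : Matrix (Fin 2) (Fin 2) F) i 1
  map_add' _ _ := rfl
  map_smul' _ _ := rfl
  invFun f := ⟨Matrix.of fun i j => if j = 1 then f i else 0, fun i => by simp⟩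
  left_inv u := by
    have hu : ∀ i, (u : Matrix (Fin 2) (Fin 2) F) i 0 = 0 := u.2
    ext i j
    fin_cases j <;> simp [hu]
  right_inv f := by
    ext i
    simp

/-- The coordinates of the elements of `A`. -/
def coordEquiv : MatrixPlusIdeal F ≃ₗ[F] Matrix (Fin 2) (Fin 2) F × (Fin 2 → F) :=
  LinearEquiv.prodCongr (M := Matrix (Fin 2) (Fin 2) F) (LinearEquiv.refl F _) (idealEquiv F)

instance : Module.Finite F (MatrixPlusIdeal F) :=
  Module.Finite.equiv (coordEquiv F).symm

theorem finrank_eq : Module.finrank F (MatrixPlusIdeal F) = 6 := by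
  rw [(coordEquiv F).finrank_eq, Module.finrank_prod, Module.finrank_matrix]
  simp

end MatrixPlusIdeal

/-- The homogeneous elements `(e_{rc}, 0)` and `(e_{r2}, e_{r2})` of `A`; the value at `(e₂, r, c)`
is `0` when `c` is the first column. -/
def gradedUnit : T3 × Fin 2 × Fin 2 → MatrixPlusIdeal F
  | (T3.e1, r, c) => (Matrix.single r c 1, 0)
  | (T3.e2, r, c) => (if c = 1 then Matrix.single r 1 1 else 0,
      ⟨if c = 1 then Matrix.single r 1 1 else 0, fun i => by split_ifs <;> simp [Matrix.single]⟩)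

/-- The labels of nonzero homogeneous matrix units. -/
def IsValidLabel (p : T3 × Fin 2 × Fin 2) : Prop :=
  p.1 = T3.e2 → p.2.2 = 1

instance : DecidablePred IsValidLabel := fun _ => inferInstanceAs (Decidable (_ → _))

theorem gradedUnit_mem (p : T3 × Fin 2 × Fin 2) : gradedUnit F p ∈ T3.component F p.1 := by
  obtain ⟨_ | _, r, c⟩ := p
  · exact rfl
  · exact rfl

theorem gradedUnit_of_not_isValidLabel {p : T3 × Fin 2 × Fin 2} (h : ¬IsValidLabel p) :
    gradedUnit F p = 0 := by
  obtain ⟨_ | _, r, c⟩ := p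
  · exact absurd (fun h => by cases h) h
  · have hc : c ≠ 1 := fun e => h fun _ => e
    refine MatrixPlusIdeal.ext_matrix ?_ ?_
    · exact if_neg hc
    · exact if_neg hc

instance : Fintype T3 := ⟨{T3.e1, T3.e2}, by rintro (_ | _) <;> simp⟩

theorem T3.sum_univ {M : Type*} [AddCommMonoid M] (f : T3 → M) :
    ∑ t, f t = f T3.e1 + f T3.e2 :=
  sum_pair (by decide)

-- An element of either component is determined by its first coordinate, so the entries of that
-- matrix serve as coefficients.
variable {F} in
theorem eq_sum_gradedUnit {t : T3} {a : MatrixPlusIdeal F} (ha : a ∈ T3.component F t) :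
    a = ∑ p : T3 × Fin 2 × Fin 2, a.1 p.2.1 p.2.2 • if p.1 = t then gradedUnit F p else 0 := by
  have hsum : ∑ p : T3 × Fin 2 × Fin 2, a.1 p.2.1 p.2.2 • (if p.1 = t then gradedUnit F p else 0) =
      ∑ r, ∑ c, a.1 r c • gradedUnit F (t, r, c) := by
    rw [Fintype.sum_prod_type, T3.sum_univ, Fintype.sum_prod_type, Fintype.sum_prod_type]
    cases t <;> simp
  rw [hsum]
  simp only [Fin.sum_univ_two]
  have h2 : ∀ i, (a.2 : Matrix (Fin 2) (Fin 2) F) i 0 = 0 := a.2.2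
  cases t with
  | e1 =>
    have ha : a.2 = 0 := ha
    refine MatrixPlusIdeal.ext_matrix ?_ ?_
    · change a.1 = a.1 0 0 • Matrix.single 0 0 1 + a.1 0 1 • Matrix.single 0 1 1 +
        (a.1 1 0 • Matrix.single 1 0 1 + a.1 1 1 • Matrix.single 1 1 1)
      ext i j
      fin_cases i <;> fin_cases j <;> simp [Matrix.single]
    · rw [ha]
      change (0 : Matrix (Fin 2) (Fin 2) F) = a.1 0 0 • 0 + a.1 0 1 • 0 + (a.1 1 0 • 0 + a.1 1 1 • 0)
      simp
  | e2 =>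
    have ha : a.1 = a.2 := ha
    have key : (a.2 : Matrix (Fin 2) (Fin 2) F) =
        a.1 0 0 • (if (0 : Fin 2) = 1 then Matrix.single 0 1 1 else 0) +
          a.1 0 1 • (if (1 : Fin 2) = 1 then Matrix.single 0 1 1 else 0) +
        (a.1 1 0 • (if (0 : Fin 2) = 1 then Matrix.single 1 1 1 else 0) +
          a.1 1 1 • (if (1 : Fin 2) = 1 then Matrix.single 1 1 1 else 0)) := by
      rw [ha]
      ext i j
      fin_cases i <;> fin_cases j <;> simp [Matrix.single, h2]
    exact MatrixPlusIdeal.ext_matrix (ha.trans key) key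

/-- The type of a product is that of its right factor. Only the left label must be valid: an invalid
right label makes both sides zero. -/
theorem gradedUnit_mul {p q : T3 × Fin 2 × Fin 2} (hp : IsValidLabel p) :
    gradedUnit F p * gradedUnit F q =
      if p.2.2 = q.2.1 then gradedUnit F (q.1, p.2.1, q.2.2) else 0 := by
  obtain ⟨s, i, j⟩ := p
  obtain ⟨t, r, c⟩ := q
  have h1 : (gradedUnit F (s, i, j)).1 = Matrix.single i j 1 := by
    cases s with
    | e1 => rfl
    | e2 =>
      obtain rfl : j = 1 := hp rfl
      rfl
  have h2 : (if j = r then gradedUnit F (t, i, c) else 0).1 =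
      if j = r then (gradedUnit F (t, i, c)).1 else 0 := by
    split_ifs <;> rfl
  have h3 : ((if j = r then gradedUnit F (t, i, c) else 0).2 : Matrix (Fin 2) (Fin 2) F) =
      if j = r then ((gradedUnit F (t, i, c)).2 : Matrix (Fin 2) (Fin 2) F) else 0 := by
    split_ifs <;> rfl
  have hs : ∀ c' : Fin 2, Matrix.single i j (1 : F) * Matrix.single r c' 1 =
      if j = r then Matrix.single i c' 1 else 0 := by
    intro c'
    split_ifs with h
    · subst h
      simp
    · exact Matrix.single_mul_single_of_ne _ _ _ _ h _
  have hs' : Matrix.single i j (1 : F) * (if c = 1 then Matrix.single r 1 1 else 0) =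
      if j = r then (if c = 1 then Matrix.single i 1 1 else 0) else 0 := by
    split_ifs with hc hj <;> simp_all
  refine MatrixPlusIdeal.ext_matrix ?_ ?_
  · change (gradedUnit F (s, i, j)).1 * (gradedUnit F (t, r, c)).1 = _
    rw [h1, h2]
    cases t with
    | e1 => exact hs c
    | e2 => exact hs'
  · change (gradedUnit F (s, i, j)).1 * ((gradedUnit F (t, r, c)).2 : Matrix (Fin 2) (Fin 2) F) = _
    rw [h1, h3]
    cases t with
    | e1 => exact (mul_zero _).trans (ite_self _).symm
    | e2 => exact hs'

/-- The functional reading the lower right entry of the first component. -/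
def lowerRightEntry : MatrixPlusIdeal F →ₗ[F] F :=
  (Matrix.entryLinearMap F F 1 1).comp (MatrixPlusIdeal.fstₗ F)

theorem lowerRightEntry_gradedUnit_eq_zero {p : T3 × Fin 2 × Fin 2} (hp : p.2 ≠ (1, 1)) :
    lowerRightEntry F (gradedUnit F p) = 0 := by
  obtain ⟨t, r, c⟩ := p
  cases t with
  | e1 =>
    change (Matrix.single r c 1 : Matrix (Fin 2) (Fin 2) F) 1 1 = 0
    rw [Matrix.single, Matrix.of_apply, if_neg]
    rintro ⟨rfl, rfl⟩
    exact hp rfl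
  | e2 =>
    change (if c = 1 then Matrix.single r 1 1 else 0 : Matrix (Fin 2) (Fin 2) F) 1 1 = 0
    split_ifs with hc
    · rw [Matrix.single, Matrix.of_apply, if_neg]
      rintro ⟨rfl, -⟩
      exact hp (by rw [hc])
    · rfl

theorem lowerRightEntry_gradedUnit (t : T3) : lowerRightEntry F (gradedUnit F (t, 1, 1)) = 1 := by
  cases t <;> exact Matrix.single_apply_same (1 : Fin 2) (1 : Fin 2) (1 : F)

theorem prod_inr_gradedUnit (p : T3 × Fin 2 × Fin 2) (l : List (T3 × Fin 2 × Fin 2))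
    (h : ∀ q ∈ p :: l, IsValidLabel q) :
    ((p :: l).map fun q => (Unitization.inr (gradedUnit F q) :
        Unitization F (MatrixPlusIdeal F))).prod =
      Unitization.inr (if (p :: l).IsChain (fun a b => a.2.2 = b.2.1) then
        gradedUnit F (((p :: l).getLast (by simp)).1, p.2.1, ((p :: l).getLast (by simp)).2.2)
        else 0) := by
  induction l generalizing p with
  | nil => simp
  | cons q l ih =>
    rw [List.map_cons, List.prod_cons, ih q fun x hx => h x (List.mem_cons_of_mem _ hx),
      ← Unitization.inr_mul]
    congr 1
    simp only [List.isChain_cons_cons]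
    by_cases hl : (q :: l).IsChain (fun a b => a.2.2 = b.2.1)
    · simp only [hl, if_true, and_true]
      rw [gradedUnit_mul F (h p List.mem_cons_self), List.getLast_cons (List.cons_ne_nil q l)]
    · simp [hl]

/-- The homogeneous substitution of matrix units for the variables `x⁽ᵗ⁾ᵢ`, `i < n`: the variables
`x⁽ᵗ⁾ᵢ` for which `t` is not the type of the `i`th label are replaced by `0`. -/
def unitSubst {n : ℕ} (s : Fin n → T3 × Fin 2 × Fin 2) (v : T3 × ℕ) : MatrixPlusIdeal F :=
  if h : v.2 < n then if (s ⟨v.2, h⟩).1 = v.1 then gradedUnit F (s ⟨v.2, h⟩) else 0 else 0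

theorem unitSubst_mem {n : ℕ} (s : Fin n → T3 × Fin 2 × Fin 2) (t : T3) (i : ℕ) :
    unitSubst F s (t, i) ∈ T3.component F t := by
  rw [unitSubst]
  split_ifs with h ht
  · have := gradedUnit_mem F (s ⟨i, h⟩)
    rwa [show (s ⟨i, h⟩).1 = t from ht] at this
  · exact zero_mem _
  · exact zero_mem _

theorem unitSubst_fin {n : ℕ} (s : Fin n → T3 × Fin 2 × Fin 2) (t : T3) (i : Fin n) :
    unitSubst F s (t, (i : ℕ)) = if (s i).1 = t then gradedUnit F (s i) else 0 := by
  simp [unitSubst]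

variable {n : ℕ}

/-- The labels `s` in the order `κ` match the types `t` and form a path. -/
structure IsLabelPath (s : Fin (n + 1) → T3 × Fin 2 × Fin 2) (κ : Equiv.Perm (Fin (n + 1)))
    (t : Fin (n + 1) → T3) : Prop where
  type_eq : ∀ i, (s (κ i)).1 = t i
  valid : ∀ i, IsValidLabel (s i)
  path : ∀ i : Fin n, (s (κ i.castSucc)).2.2 = (s (κ i.succ)).2.1

variable {s : Fin (n + 1) → T3 × Fin 2 × Fin 2} {κ : Equiv.Perm (Fin (n + 1))}
  {t : Fin (n + 1) → T3} {w : FreeSemigroup (T3 × ℕ)}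

theorem IsLabelPath.lift_unitSubst (h : IsLabelPath s κ t)
    (hw : w.head :: w.tail = List.ofFn fun i => (t i, (κ i : ℕ))) :
    FreeSemigroup.lift (unitSubst F s) w = gradedUnit F
      ((s (κ (Fin.last n))).1, (s (κ 0)).2.1, (s (κ (Fin.last n))).2.2) := by
  apply Unitization.inr_injective (R := F)
  rw [FreeSemigroup.inr_lift, hw, List.map_ofFn]
  have e : ((fun v => (Unitization.inr (unitSubst F s v) : Unitization F (MatrixPlusIdeal F))) ∘
      fun i => (t i, (κ i : ℕ))) =
      (fun q => (Unitization.inr (gradedUnit F q) : Unitization F (MatrixPlusIdeal F))) ∘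
        fun i => s (κ i) := by
    funext i
    simp [unitSubst_fin, h.type_eq]
  have hchain : (List.ofFn fun i => s (κ i)).IsChain (fun a b => a.2.2 = b.2.1) := by
    rw [List.isChain_ofFn]
    intro i hi
    exact h.path ⟨i, by omega⟩
  have hlast : ∀ hne, (List.ofFn fun i => s (κ i)).getLast hne = s (κ (Fin.last n)) := by
    intro hne
    rw [List.getLast_ofFn]
    rfl
  rw [e, ← List.map_ofFn]
  rw [List.ofFn_succ] at hchain hlast ⊢
  rw [prod_inr_gradedUnit, if_pos hchain, hlast]
  intro q hq
  rw [← List.ofFn_succ (f := fun i => s (κ i)), List.mem_ofFn] at hq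
  obtain ⟨i, rfl⟩ := hq
  exact h.valid _

theorem isLabelPath_of_lift_unitSubst_ne_zero
    (hw : w.head :: w.tail = List.ofFn fun i => (t i, (κ i : ℕ)))
    (hne : FreeSemigroup.lift (unitSubst F s) w ≠ 0) : IsLabelPath s κ t := by
  have hne' : (Unitization.inr (FreeSemigroup.lift (unitSubst F s) w) :
      Unitization F (MatrixPlusIdeal F)) ≠ 0 := fun h =>
    hne (Unitization.inr_injective (R := F) (h.trans (Unitization.inr_zero F).symm))
  rw [FreeSemigroup.inr_lift, hw, List.map_ofFn] at hne'
  have hval : ∀ i, unitSubst F s (t i, (κ i : ℕ)) ≠ 0 := by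
    intro i hi
    refine hne' (List.prod_eq_zero ?_)
    rw [List.mem_ofFn]
    exact ⟨i, by simp [hi]⟩
  have htype : ∀ i, (s (κ i)).1 = t i := by
    intro i
    by_contra hi
    exact hval i (by rw [unitSubst_fin, if_neg hi])
  have hvalid : ∀ i, IsValidLabel (s i) := by
    intro i
    by_contra hi
    refine hval (κ.symm i) ?_
    rw [unitSubst_fin, κ.apply_symm_apply, gradedUnit_of_not_isValidLabel F hi, ite_self]
  refine ⟨htype, hvalid, ?_⟩
  have e : ((fun v => (Unitization.inr (unitSubst F s v) : Unitization F (MatrixPlusIdeal F))) ∘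
      fun i => (t i, (κ i : ℕ))) =
      (fun q => (Unitization.inr (gradedUnit F q) : Unitization F (MatrixPlusIdeal F))) ∘
        fun i => s (κ i) := by
    funext i
    simp [unitSubst_fin, htype]
  have hchain : (List.ofFn fun i => s (κ i)).IsChain (fun a b => a.2.2 = b.2.1) := by
    by_contra hchain
    refine hne' ?_
    rw [e, ← List.map_ofFn]
    rw [List.ofFn_succ] at hchain ⊢
    rw [prod_inr_gradedUnit, if_neg hchain, Unitization.inr_zero]
    intro q hq
    rw [← List.ofFn_succ (f := fun i => s (κ i)), List.mem_ofFn] at hq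
    obtain ⟨i, rfl⟩ := hq
    exact hvalid _
  rw [List.isChain_ofFn] at hchain
  exact fun i => hchain i (by omega)

end Algebra

/-! Upper bound -/

section UpperBound

open Finset

theorem gradedEval_single {F T A : Type*} [Field F] [NonUnitalRing A] [Module F A]
    [IsScalarTower F A A] [SMulCommClass F A A] (a : T × ℕ → A) (w : FreeSemigroup (T × ℕ)) :
    gradedEval a (MonoidAlgebra.single w (1 : F)) = FreeSemigroup.lift a w := by
  simp [gradedEval, MonoidAlgebra.liftMagma_apply_apply]

variable {F : Type*} [Field F]

/-- The coefficients do not depend on the monomial: `s` is indexed by variables rather than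
positions, and `unitSubst` kills mismatched types. Hence the expansion extends linearly to all of
`multilinearPart`. -/
theorem lift_eq_sum_unitSubst {n : ℕ} {a : T3 × ℕ → MatrixPlusIdeal F}
    (ha : ∀ t i, a (t, i) ∈ T3.component F t) {w : FreeSemigroup (T3 × ℕ)}
    {κ : Equiv.Perm (Fin n)} {t : Fin n → T3}
    (hw : w.head :: w.tail = List.ofFn fun i => (t i, (κ i : ℕ))) :
    FreeSemigroup.lift a w = ∑ s : Fin n → T3 × Fin 2 × Fin 2,
      (∏ j : Fin n, (a ((s j).1, j)).1 (s j).2.1 (s j).2.2) •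
        FreeSemigroup.lift (unitSubst F s) w := by
  apply Unitization.inr_injective (R := F)
  change _ = Unitization.inrNonUnitalAlgHom F _ _
  rw [map_sum, FreeSemigroup.inr_lift, hw, List.map_ofFn]
  have e : ((fun v => (Unitization.inr (a v) : Unitization F (MatrixPlusIdeal F))) ∘
      fun i => (t i, (κ i : ℕ))) = fun i => ∑ p : T3 × Fin 2 × Fin 2,
        (a (p.1, κ i)).1 p.2.1 p.2.2 • (Unitization.inr
          (if p.1 = t i then gradedUnit F p else 0) : Unitization F (MatrixPlusIdeal F)) := by
    funext i
    change Unitization.inrNonUnitalAlgHom F _ (a (t i, κ i)) = _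
    conv_lhs => rw [eq_sum_gradedUnit (ha (t i) (κ i)), map_sum]
    refine sum_congr rfl fun p _ => ?_
    rw [map_smul]
    by_cases hp : p.1 = t i
    · rw [hp]
      rfl
    · rw [if_neg hp, map_zero, smul_zero, Unitization.inr_zero, smul_zero]
  rw [e]
  refine (MultilinearMap.mkPiAlgebraFin_apply (R := F)
    (A := Unitization F (MatrixPlusIdeal F)) _).symm.trans ?_
  rw [MultilinearMap.map_sum, ← (Equiv.arrowCongr κ.symm (Equiv.refl _)).sum_comp]
  refine sum_congr rfl fun s _ => ?_
  rw [MultilinearMap.map_smul_univ, map_smul, MultilinearMap.mkPiAlgebraFin_apply]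
  simp only [Equiv.arrowCongr_apply, Equiv.coe_refl, Function.comp_apply, id_eq, Equiv.symm_symm]
  rw [Equiv.prod_comp κ fun j => (a ((s j).1, j)).1 (s j).2.1 (s j).2.2]
  congr 1
  change _ = Unitization.inr _
  rw [FreeSemigroup.inr_lift, hw, List.map_ofFn]
  congr 2
  funext i
  simp [unitSubst_fin]

theorem gradedEval_eq_sum_unitSubst {n : ℕ} {a : T3 × ℕ → MatrixPlusIdeal F}
    (ha : ∀ t i, a (t, i) ∈ T3.component F t) {f : FreeGradedAlgebra F T3}
    (hf : f ∈ multilinearPart F T3 n) :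
    gradedEval a f = ∑ s : Fin n → T3 × Fin 2 × Fin 2,
      (∏ j : Fin n, (a ((s j).1, j)).1 (s j).2.1 (s j).2.2) • gradedEval (unitSubst F s) f := by
  induction hf using Submodule.span_induction with
  | mem f hf =>
    obtain ⟨w, κ, t, hw, rfl⟩ := hf
    simp only [gradedEval_single]
    exact lift_eq_sum_unitSubst ha hw
  | zero => simp
  | add f g _ _ hf hg => simp only [map_add, smul_add, sum_add_distrib, hf, hg]
  | smul c f _ hf =>
    simp only [map_smul, hf, smul_sum]
    exact sum_congr rfl fun s _ => smul_comm _ _ _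

/-- The torus weight of a matrix unit. -/
def labelWeight (p : T3 × Fin 2 × Fin 2) : ℤ := (p.2.2 : ℤ) - (p.2.1 : ℤ)

/-- The tuples of valid labels whose total torus weight is that of a matrix unit. -/
def balancedLabels (n : ℕ) : Finset (Fin n → T3 × Fin 2 × Fin 2) :=
  {s ∈ Fintype.piFinset fun _ => {p | IsValidLabel p} | |∑ i, labelWeight (s i)| ≤ 1}

theorem IsLabelPath.mem_balancedLabels {n : ℕ} {s : Fin (n + 1) → T3 × Fin 2 × Fin 2}
    {κ : Equiv.Perm (Fin (n + 1))} {t : Fin (n + 1) → T3} (h : IsLabelPath s κ t) :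
    s ∈ balancedLabels (n + 1) := by
  refine mem_filter.2 ⟨Fintype.mem_piFinset.2 fun i => mem_filter.2 ⟨mem_univ _, h.valid i⟩, ?_⟩
  have : ∑ i, labelWeight (s i) =
      ((s (κ (Fin.last n))).2.2 : ℤ) - ((s (κ 0)).2.1 : ℤ) := by
    rw [← Equiv.sum_comp κ]
    simp only [labelWeight, sum_sub_distrib]
    rw [Fin.sum_univ_castSucc, Fin.sum_univ_succ (fun i => ((s (κ i)).2.1 : ℤ))]
    simp only [h.path]
    ring
  rw [this, abs_le]
  omega

theorem gradedEval_unitSubst_eq_zero {n : ℕ} {s : Fin n → T3 × Fin 2 × Fin 2}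
    (hs : s ∉ balancedLabels n) {f : FreeGradedAlgebra F T3} (hf : f ∈ multilinearPart F T3 n) :
    gradedEval (unitSubst F s) f = 0 := by
  induction hf using Submodule.span_induction with
  | mem f hf =>
    obtain ⟨w, κ, t, hw, rfl⟩ := hf
    rw [gradedEval_single]
    cases n with
    | zero => simp at hw
    | succ n =>
      by_contra hne
      exact hs (isLabelPath_of_lift_unitSubst_ne_zero F hw hne).mem_balancedLabels
  | zero => simp
  | add f g _ _ hf hg => rw [map_add, hf, hg, add_zero]
  | smul c f _ hf => rw [map_smul, hf, smul_zero]

variable (F) in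
/-- Evaluation of multilinear polynomials at a tuple of matrix units. -/
noncomputable def unitEval {n : ℕ} (s : Fin n → T3 × Fin 2 × Fin 2) :
    multilinearPart F T3 n →ₗ[F] MatrixPlusIdeal F where
  toFun f := gradedEval (F := F) (unitSubst F s) (f : FreeGradedAlgebra F T3)
  map_add' f g := by rw [Submodule.coe_add, map_add]
  map_smul' c f := by rw [Submodule.coe_smul, map_smul, RingHom.id_apply]

variable (F) in
/-- Evaluation of multilinear polynomials at all balanced tuples of matrix units. -/
noncomputable def balancedEval (n : ℕ) :
    multilinearPart F T3 n →ₗ[F] (balancedLabels n → MatrixPlusIdeal F) :=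
  LinearMap.pi fun s => unitEval F s.1

theorem ker_balancedEval (n : ℕ) : LinearMap.ker (balancedEval F n) =
    (gradedIdentities (T3.grading F)).submoduleOf (multilinearPart F T3 n) := by
  ext f
  constructor
  · intro hf a ha
    change gradedEval a (f : FreeGradedAlgebra F T3) = 0
    rw [gradedEval_eq_sum_unitSubst ha f.2]
    refine sum_eq_zero fun s _ => ?_
    by_cases hs : s ∈ balancedLabels n
    · have : gradedEval (unitSubst F s) (f : FreeGradedAlgebra F T3) = 0 :=
        congrFun hf ⟨s, hs⟩
      rw [this, smul_zero]
    · rw [gradedEval_unitSubst_eq_zero hs f.2, smul_zero]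
  · intro hf
    exact funext fun s => hf _ (unitSubst_mem F s.1)

variable (F) in
/-- The embedding of `Pₙ / (Pₙ ∩ Id)` into a finite-dimensional space. -/
noncomputable def quotientEval (n : ℕ) :
    (multilinearPart F T3 n ⧸ (gradedIdentities (T3.grading F)).submoduleOf
      (multilinearPart F T3 n)) →ₗ[F] (balancedLabels n → MatrixPlusIdeal F) :=
  Submodule.liftQ _ (balancedEval F n) (ker_balancedEval n).ge

theorem quotientEval_injective (n : ℕ) : Function.Injective (quotientEval F n) :=
  LinearMap.ker_eq_bot.1 (Submodule.ker_liftQ_eq_bot _ _ _ (ker_balancedEval n).le)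

instance (n : ℕ) : Module.Finite F (multilinearPart F T3 n ⧸
    (gradedIdentities (T3.grading F)).submoduleOf (multilinearPart F T3 n)) :=
  Module.Finite.of_injective _ (quotientEval_injective n)

variable (F) in
theorem gradedCodim_le_card (n : ℕ) :
    gradedCodim (T3.grading F) n ≤ #(balancedLabels n) * 6 := by
  refine (LinearMap.finrank_le_finrank_of_injective (quotientEval_injective n)).trans ?_
  rw [Module.finrank_pi_fintype]
  simp [MatrixPlusIdeal.finrank_eq]

/-- Exponential weighting with base √2, the minimizer of 3 + x + 2/x. A total weight of at most 1
costs the extra factor √2. -/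
theorem card_balancedLabels_le (n : ℕ) :
    (#(balancedLabels n) : ℝ) ≤ √2 * (3 + 2 * √2) ^ n := by
  have h2 : √2 * √2 = 2 := Real.mul_self_sqrt (by norm_num)
  have hpos : 0 < √2 := by positivity
  have h1 : 1 ≤ √2 := by
    rw [Real.one_le_sqrt]
    norm_num
  have hsum : ∑ p : T3 × Fin 2 × Fin 2 with IsValidLabel p, √2 ^ (-labelWeight p) =
      3 + 2 * √2 := by
    rw [sum_filter, Fintype.sum_prod_type, T3.sum_univ, Fintype.sum_prod_type,
      Fintype.sum_prod_type]
    simp only [Fin.sum_univ_two]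
    simp [IsValidLabel, labelWeight]
    field_simp
    linear_combination (-1 : ℝ) * h2
  calc (#(balancedLabels n) : ℝ) = ∑ s ∈ balancedLabels n, (1 : ℝ) := by simp
    _ ≤ ∑ s ∈ balancedLabels n, √2 * ∏ i, √2 ^ (-labelWeight (s i)) := by
        refine sum_le_sum fun s hs => ?_
        have hs := (abs_le.1 (mem_filter.1 hs).2).2
        have hprod : ∏ i, √2 ^ (-labelWeight (s i)) = √2 ^ (-∑ i, labelWeight (s i)) := by
          rw [← sum_neg_distrib]
          generalize (univ : Finset (Fin n)) = u
          induction u using Finset.cons_induction with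
          | empty => simp
          | cons i u hi ih => rw [prod_cons, sum_cons, ih, zpow_add₀ hpos.ne']
        rw [hprod, ← zpow_one_add₀ hpos.ne']
        exact one_le_zpow₀ h1 (by omega)
    _ ≤ ∑ s ∈ Fintype.piFinset fun _ : Fin n => {p | IsValidLabel p},
          √2 * ∏ i, √2 ^ (-labelWeight (s i)) :=
        sum_le_sum_of_subset_of_nonneg (filter_subset _ _) fun s _ _ => by positivity
    _ = √2 * (3 + 2 * √2) ^ n := by
        rw [← mul_sum, sum_prod_piFinset {p | IsValidLabel p} fun _ p => √2 ^ (-labelWeight p)]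
        rw [prod_const, hsum, card_univ, Fintype.card_fin]

end UpperBound

/-! Lower bound -/

section LowerBound

open Finset

theorem linearIndependent_of_triangular {ι F M : Type*} [Field F] [AddCommGroup M] [Module F M]
    {v : ι → M} (φ : ι → M →ₗ[F] F) (W : ι → ℤ) (hφ : ∀ i, φ i (v i) ≠ 0)
    (hW : ∀ i j, i ≠ j → φ i (v j) ≠ 0 → W i < W j) : LinearIndependent F v := by
  classical
  rw [linearIndependent_iff']
  intro s c hc
  by_contra! hex
  obtain ⟨i, hi, hmax⟩ := exists_max_image {i ∈ s | c i ≠ 0} W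
    (by obtain ⟨i, hi⟩ := hex; exact ⟨i, mem_filter.2 hi⟩)
  rw [mem_filter] at hi
  have h := congrArg (φ i) hc
  rw [map_sum, map_zero, sum_eq_single_of_mem i hi.1] at h
  · rw [map_smul, smul_eq_mul] at h
    exact mul_ne_zero hi.2 (hφ i) h
  · intro j hj hji
    rw [map_smul, smul_eq_mul]
    by_contra hne
    exact (hmax j (mem_filter.2 ⟨hj, left_ne_zero_of_mul hne⟩)).not_gt
      (hW i j hji.symm (right_ne_zero_of_mul hne))

theorem exists_equiv_of_sameCycle {V : Type*} [Fintype V] {σ : Equiv.Perm V} {z : V}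
    (h : ∀ v, σ.SameCycle z v) {m : ℕ} (hV : Fintype.card V = m + 1) (w : V) :
    ∃ κ : Fin (m + 1) ≃ V, (∀ i : Fin m, κ i.succ = σ (κ i.castSucc)) ∧
      κ (Fin.last m) = w ∧ κ 0 = σ w := by
  have hcyc : σ.IsCycleOn ((univ : Finset V) : Set V) :=
    ⟨by simp, fun x _ y _ => (h x).symm.trans (h y)⟩
  -- The exponent `i + 1` makes the enumeration start at `σ w` and end at `w`.
  have hinj : Function.Injective fun i : Fin (m + 1) => (σ ^ ((i : ℕ) + 1)) w := by
    intro i j hij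
    have := (hcyc.pow_apply_eq_pow_apply (mem_univ w)).1 hij
    rw [card_univ, hV] at this
    have := Nat.ModEq.add_right_cancel' 1 this
    exact Fin.ext (this.eq_of_lt_of_lt i.2 j.2)
  refine ⟨Equiv.ofBijective _ ((Fintype.bijective_iff_injective_and_card _).2
    ⟨hinj, by rw [Fintype.card_fin, hV]⟩), fun i => ?_, ?_, ?_⟩
  · simp [pow_succ']
  · have := hcyc.pow_card_apply (mem_univ w)
    rw [card_univ, hV] at this
    simpa using this
  · simp

variable {V : Type*} [DecidableEq V]

/-- The labels of the matrix units substituted for the variables: the variables from `K` are of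
type `e₁`, those from `B` have the upper row, those from `A` the left column. -/
def tripleLabel (g : Finset V × Finset V × Finset V) (v : V) : T3 × Fin 2 × Fin 2 :=
  (if v ∈ g.1 then T3.e1 else T3.e2, if v ∈ g.2.2 then 0 else 1, if v ∈ g.2.1 then 0 else 1)

variable {F : Type*} [Field F]

variable (F) in
/-- The functional on `Pₙ / (Pₙ ∩ Id)` reading the lower right entry of a value. -/
noncomputable def entryFunctional {n : ℕ} (s : Fin n → T3 × Fin 2 × Fin 2) :
    (multilinearPart F T3 n ⧸ (gradedIdentities (T3.grading F)).submoduleOf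
      (multilinearPart F T3 n)) →ₗ[F] F :=
  Submodule.liftQ _ ((lowerRightEntry F).comp (unitEval F s)) fun f hf => by
    have h : unitEval F s f = 0 := hf _ (unitSubst_mem F s)
    rw [LinearMap.mem_ker, LinearMap.comp_apply, h, map_zero]

variable (F) in
/-- The monomial with the variables in the order `κ`, of types `t`. -/
noncomputable def orderedMonomial {m : ℕ} (κ : Equiv.Perm (Fin (m + 1))) (t : Fin (m + 1) → T3) :
    multilinearPart F T3 (m + 1) :=
  ⟨MonoidAlgebra.single ⟨(t 0, (κ 0 : ℕ)), List.ofFn fun i : Fin m => (t i.succ, (κ i.succ : ℕ))⟩ 1,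
    Submodule.subset_span ⟨_, κ, t, (List.ofFn_succ (f := fun i => (t i, (κ i : ℕ)))).symm, rfl⟩⟩

theorem entryFunctional_orderedMonomial_of_ne_zero {m : ℕ} {s : Fin (m + 1) → T3 × Fin 2 × Fin 2}
    {κ : Equiv.Perm (Fin (m + 1))} {t : Fin (m + 1) → T3}
    (h : entryFunctional F s (Submodule.Quotient.mk (orderedMonomial F κ t)) ≠ 0) :
    IsLabelPath s κ t ∧ (s (κ 0)).2.1 = 1 ∧ (s (κ (Fin.last m))).2.2 = 1 := by
  have hw := (List.ofFn_succ (f := fun i => (t i, (κ i : ℕ)))).symm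
  change lowerRightEntry F (gradedEval (unitSubst F s) (MonoidAlgebra.single _ 1)) ≠ 0 at h
  rw [gradedEval_single] at h
  have hpath : IsLabelPath s κ t := isLabelPath_of_lift_unitSubst_ne_zero F hw fun e => h (by
    rw [e, map_zero])
  refine ⟨hpath, ?_⟩
  rw [hpath.lift_unitSubst F hw] at h
  by_contra hne
  exact h (lowerRightEntry_gradedUnit_eq_zero F fun e =>
    hne ⟨congrArg Prod.fst e, congrArg Prod.snd e⟩)

theorem IsLabelPath.entryFunctional_orderedMonomial {m : ℕ}
    {s : Fin (m + 1) → T3 × Fin 2 × Fin 2} {κ : Equiv.Perm (Fin (m + 1))} {t : Fin (m + 1) → T3}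
    (h : IsLabelPath s κ t) (h0 : (s (κ 0)).2.1 = 1) (hlast : (s (κ (Fin.last m))).2.2 = 1) :
    entryFunctional F s (Submodule.Quotient.mk (orderedMonomial F κ t)) = 1 := by
  have hw := (List.ofFn_succ (f := fun i => (t i, (κ i : ℕ)))).symm
  change lowerRightEntry F (gradedEval (unitSubst F s) (MonoidAlgebra.single _ 1)) = 1
  rw [gradedEval_single, h.lift_unitSubst F hw, h0, hlast, lowerRightEntry_gradedUnit]

-- To each triple belongs the monomial following its cyclic permutation and ending at `w`, and the
-- functional evaluating at its labels. The value matrix is triangular for `heightWeight`.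
variable (F) in
theorem card_le_gradedCodim [Fintype V] {m : ℕ} (e : Fin (m + 1) ≃ V) {pos : V → ℤ} {z w : V}
    {G : Finset (Finset V × Finset V × Finset V)}
    (hG : ∀ g ∈ G, IsDominating pos g.1 g.2.1 g.2.2 z w) :
    #G ≤ gradedCodim (T3.grading F) (m + 1) := by
  have hcard : Fintype.card V = m + 1 := by rw [← Fintype.card_congr e, Fintype.card_fin]
  have hex : ∀ g : G, ∃ (σ : Equiv.Perm V) (κ : Fin (m + 1) ≃ V),
      IsCompatible pos g.1.1 g.1.2.1 g.1.2.2 σ ∧ (∀ i : Fin m, κ i.succ = σ (κ i.castSucc)) ∧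
      κ (Fin.last m) = w ∧ κ 0 = σ w := by
    intro g
    obtain ⟨σ, hσ, hcyc⟩ := (hG g g.2).exists_isCompatible_sameCycle
    obtain ⟨κ, hκ⟩ := exists_equiv_of_sameCycle hcyc hcard w
    exact ⟨σ, κ, hσ, hκ⟩
  choose σ κ hσ hsucc hlast hzero using hex
  have hli : LinearIndependent F fun g : G =>
      (Submodule.Quotient.mk (orderedMonomial F ((κ g).trans e.symm)
        fun i => (tripleLabel g.1 (κ g i)).1) :
        multilinearPart F T3 (m + 1) ⧸ (gradedIdentities (T3.grading F)).submoduleOf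
          (multilinearPart F T3 (m + 1))) := by
    refine linearIndependent_of_triangular
      (fun g => entryFunctional F fun i => tripleLabel g.1 (e i))
      (fun g => heightWeight pos g.1.2.1 g.1.2.2) (fun g => ?_) fun g g' hne h => ?_
    · have hd := hG g g.2
      have hmem := (hσ g).mem_iff
      rw [IsLabelPath.entryFunctional_orderedMonomial]
      · exact one_ne_zero
      · refine ⟨fun i => by simp, fun i hi => ?_, fun i => ?_⟩
        · have hK : e i ∉ g.1.1 := fun hK => by simp [tripleLabel, hK] at hi
          simpa [tripleLabel] using fun hA => hK (hd.subset hA)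
        · simp [tripleLabel, hsucc, hmem]
      · simp [tripleLabel, hzero, (hσ g).off w hd.w_notMem]
      · simpa [tripleLabel, hlast] using fun hA => hd.w_notMem (hd.subset hA)
    · obtain ⟨hpath, h0, hl⟩ := entryFunctional_orderedMonomial_of_ne_zero h
      -- A nonzero value forces equal types, hence equal K.
      have hK : g.1.1 = g'.1.1 := by
        ext v
        obtain ⟨i, rfl⟩ := (κ g').surjective v
        have := hpath.type_eq i
        by_cases h1 : κ g' i ∈ g.1.1 <;> by_cases h2 : κ g' i ∈ g'.1.1 <;>
          simp [tripleLabel, h1, h2] at this ⊢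
      refine (hσ g').heightWeight_lt (hG g' g'.2).subset (hK ▸ (hG g g.2).subset) ?_ ?_
      · intro v
        obtain ⟨i, rfl⟩ := (κ g').surjective v
        induction i using Fin.lastCases with
        -- The step from `w` back to `σ w` is not part of the path; the lower right entry supplies
        -- it, forcing `w` out of A and `σ w` out of B.
        | last =>
          simp [tripleLabel, hlast] at hl
          simp [tripleLabel, hzero] at h0
          simp [hlast, hl, h0]
        | cast i =>
          have := hpath.path i
          rw [← hsucc]
          by_cases h1 : κ g' i.castSucc ∈ g.1.2.1 <;> by_cases h2 : κ g' i.succ ∈ g.1.2.2 <;>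
            simp [tripleLabel, h1, h2] at this ⊢
      · intro heq
        exact hne (Subtype.ext (Prod.ext hK heq))
  have := hli.fintype_card_le_finrank
  rwa [Fintype.card_coe] at this

variable (F) in
theorem pow_le_gradedCodim (n : ℕ) :
    (3 + 2 * √2) ^ n ≤ (n + 1 : ℝ) ^ 2 * gradedCodim (T3.grading F) (n + 2) := by
  obtain ⟨r, hr⟩ := exists_pow_le_card_dominatingTriples n
  refine hr.trans (mul_le_mul_of_nonneg_left ?_ (by positivity))
  let ext : Finset (Fin n) × Finset (Fin n) × Finset (Fin n) →
      Finset (Fin n ⊕ Bool) × Finset (Fin n ⊕ Bool) × Finset (Fin n ⊕ Bool) := fun g =>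
    (g.1.disjSum {false}, g.2.1.disjSum {false}, g.2.2.disjSum {true})
  have hdisj : ∀ {S T : Finset (Fin n)} {b : Bool}, S.disjSum {b} = T.disjSum {b} → S = T := by
    intro S T b h
    ext i
    rw [← inl_mem_disjSum (t := {b}), h, inl_mem_disjSum]
  have hext : Function.Injective ext := by
    rintro ⟨K, A, B⟩ ⟨K', A', B'⟩ h
    simp only [ext, Prod.mk.injEq] at h
    rw [hdisj h.1, hdisj h.2.1, hdisj h.2.2]
  rw [← card_image_of_injective _ hext]
  have e : Fin (n + 2) ≃ Fin n ⊕ Bool := Fintype.equivOfCardEq (by simp)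
  refine Nat.cast_le.2 (card_le_gradedCodim F (m := n + 1) e (pos := extendedHeight n r)
    (z := .inr false) (w := .inr true) fun g hg => ?_)
  obtain ⟨g', hg', rfl⟩ := mem_image.1 hg
  exact isDominating_of_mem_dominatingTriples hg'

end LowerBound

/-! The exponent -/

theorem tendsto_nthRoot_gradedCodim (F : Type*) [Field F] :
    Filter.Tendsto (fun n : ℕ => ((gradedCodim (T3.grading F) n : ℕ) : ℝ) ^ ((1 : ℝ) / (n : ℝ)))
      Filter.atTop (𝓝 (3 + 2 * √2)) := by
  set q : ℝ := 3 + 2 * √2 with hq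
  have hq0 : 0 < q := by positivity
  have hconst : ∀ c : ℝ, 0 < c →
      Filter.Tendsto (fun n : ℕ => c ^ ((1 : ℝ) / (n : ℝ))) Filter.atTop (𝓝 1) := by
    intro c hc
    have := (tendsto_const_nhds (x := c)).rpow tendsto_one_div_atTop_nhds_zero_nat (.inl hc.ne')
    simpa using this
  have hn : Filter.Tendsto (fun n : ℕ => (n : ℝ) ^ ((1 : ℝ) / (n : ℝ))) Filter.atTop (𝓝 1) :=
    tendsto_rpow_div.comp tendsto_natCast_atTop_atTop
  have hroot : ∀ n : ℕ, n ≠ 0 → (q ^ n) ^ ((1 : ℝ) / (n : ℝ)) = q := by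
    intro n hn
    rw [one_div, Real.pow_rpow_inv_natCast hq0.le hn]
  -- The factor (q²)⁻¹ comes from the two extra variables, and n · n bounds the loss (n - 1)².
  have hlow : Filter.Tendsto (fun n : ℕ => ((q ^ 2)⁻¹) ^ ((1 : ℝ) / (n : ℝ)) *
      ((n : ℝ) ^ ((1 : ℝ) / (n : ℝ)) * (n : ℝ) ^ ((1 : ℝ) / (n : ℝ)))⁻¹ * q)
      Filter.atTop (𝓝 q) := by
    have := ((hconst (q ^ 2)⁻¹ (by positivity)).mul ((hn.mul hn).inv₀ (by norm_num))).mul_const q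
    simpa using this
  have hup : Filter.Tendsto (fun n : ℕ => (6 * √2) ^ ((1 : ℝ) / (n : ℝ)) * q)
      Filter.atTop (𝓝 q) := by
    have := (hconst (6 * √2) (by positivity)).mul_const q
    simpa using this
  refine tendsto_of_tendsto_of_tendsto_of_le_of_le' hlow hup ?_ ?_
  · filter_upwards [Filter.eventually_ge_atTop 2] with n hn2
    obtain ⟨k, rfl⟩ := Nat.exists_eq_add_of_le' hn2
    have hk : (0 : ℝ) < (k + 2 : ℕ) := by positivity
    have h := pow_le_gradedCodim F k
    have h' : (q ^ 2)⁻¹ * (((k + 2 : ℕ) : ℝ) * (k + 2 : ℕ))⁻¹ * q ^ (k + 2) ≤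
        gradedCodim (T3.grading F) (k + 2) := by
      have hk' : (q ^ 2)⁻¹ * (((k + 2 : ℕ) : ℝ) * (k + 2 : ℕ))⁻¹ * q ^ (k + 2) =
          q ^ k / (((k + 2 : ℕ) : ℝ) * (k + 2 : ℕ)) := by
        have hqk : q ^ (k + 2) = q ^ 2 * q ^ k := by rw [add_comm, pow_add]
        rw [hqk]
        field_simp
      rw [hk', div_le_iff₀ (by positivity), mul_comm]
      refine h.trans (mul_le_mul_of_nonneg_right ?_ (by positivity))
      push_cast
      nlinarith [(Nat.cast_nonneg k : (0 : ℝ) ≤ k)]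
    have h1 := Real.rpow_le_rpow (by positivity) h'
      (show (0 : ℝ) ≤ 1 / ((k + 2 : ℕ) : ℝ) by positivity)
    rwa [Real.mul_rpow (by positivity) (by positivity), Real.mul_rpow (by positivity)
      (by positivity), Real.inv_rpow (mul_pos hk hk).le, Real.mul_rpow hk.le hk.le,
      hroot _ (by omega)] at h1
  · filter_upwards [Filter.eventually_ge_atTop 1] with n hn1
    have h : (gradedCodim (T3.grading F) n : ℝ) ≤ 6 * √2 * q ^ n := by
      have h1 : (gradedCodim (T3.grading F) n : ℝ) ≤ (balancedLabels n).card * 6 := by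
        exact_mod_cast gradedCodim_le_card F n
      have h2 := card_balancedLabels_le n
      linarith
    have h1 := Real.rpow_le_rpow (by positivity) h
      (show (0 : ℝ) ≤ 1 / (n : ℝ) by positivity)
    rwa [Real.mul_rpow (by positivity) (by positivity), hroot _ (by omega)] at h1

theorem sqrt_two_bounds : (1.4 : ℝ) < √2 ∧ √2 < 1.45 :=
  ⟨Real.lt_sqrt_of_sq_lt (by norm_num), (Real.sqrt_lt' (by norm_num)).2 (by norm_num)⟩

theorem mainTheorem1 (F : Type*) [Field F] [CharZero F] :
    Filter.Tendsto
        (fun n : ℕ => ((gradedCodim (T3.grading F) n : ℕ) : ℝ) ^ ((1 : ℝ) / (n : ℝ)))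
        Filter.atTop (𝓝 (3 + 2 * Real.sqrt 2)) ∧
      (¬ ∃ k : ℤ, (k : ℝ) = 3 + 2 * Real.sqrt 2) ∧
      Module.finrank F (MatrixPlusIdeal F) = 6 ∧
      3 + 2 * Real.sqrt 2 < (Module.finrank F (MatrixPlusIdeal F) : ℝ) := by
  obtain ⟨h1, h2⟩ := sqrt_two_bounds
  refine ⟨tendsto_nthRoot_gradedCodim F, ?_, MatrixPlusIdeal.finrank_eq F, ?_⟩
  · rintro ⟨k, hk⟩
    have h5 : (5 : ℝ) < k := by linarith
    have h6 : (k : ℝ) < 6 := by linarith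
    have h5' : (5 : ℤ) < k := by exact_mod_cast h5
    have h6' : k < (6 : ℤ) := by exact_mod_cast h6
    omega
  · rw [MatrixPlusIdeal.finrank_eq]
    norm_num
    linarith
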